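/- Let $(\Omega,\mathcal A,\mathbb P)$ be a probability space, $\mathcal X\subseteq\mathbb R^d$ convex, $c\in\mathbb R^d$, and $g:\mathbb R^d\times\Omega\to\mathbb R$ convex in its first argument and measurable in its second. For samples $S=(\omega_1,\dots,\omega_n)\in\Omega^n$ and $A\subseteq\{1,\dots,n\}$ consider the scenario program $$\min_{x\in\mathcal X} c^\top x\quad\text{subject to } g(x,\omega_i)\le 0\ \text{ for all } i\in A .$$ Its support set $\operatorname{supp}_S(A)$ is the set of those $i\in A$ whose removal from $A$ changes the optimal solution. Assume that, for every $n\ge d$, with $\mathbb P^n$-probability one the program with all $n$ samples is feasible and has a unique optimal solution, and that the program is fully supported: for every $n>d$, with $\mathbb P^n$-probability one the support set of the program with all $n$ samples has exactly $d$ elements. Let $m,\ell\in\mathbb N$ and $r=\ell d$. For $S\in\Omega^m$, discard $r$ samples in batches of $d$ by the cascade $A_0=\{1,\dots,m\}$, $A_{k+1}=A_k\setminus\operatorname{supp}_S(A_k)$, and let $x^\star(S)$, a random variable on $(\Omega^m,\mathbb P^m)$, be almost surely the optimal solution of the program with the remaining samples $A_\ell$. Let $V(S)=\mathbb P\{\omega\in\Omega:\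 g(x^\star(S),\omega)>0\}$ be its violation probability. Then $V$ is integrable and $$\mathbb E_{S\sim\mathbb P^m}\{V(S)\}\le\frac{r+d}{m+1}.$$ -/

import Mathlib

open MeasureTheory

/-- The data of a convex scenario program in `ℝ^d` with uncertainty in `Ω`: a convex domain `X`,
a linear objective `x ↦ cᵀ x`, and a real-valued constraint function `g`, convex in the decision
and measurable in the uncertain parameter. -/
structure ScenarioProgram (d : ℕ) (Ω : Type*) [MeasurableSpace Ω] where
  X : Set (EuclideanSpace ℝ (Fin d))
  convex_X : Convex ℝ X
  c : EuclideanSpace ℝ (Fin d)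
  g : EuclideanSpace ℝ (Fin d) → Ω → ℝ
  convex_g : ∀ ω, ConvexOn ℝ Set.univ (fun x => g x ω)
  measurable_g : ∀ x, Measurable (g x)

namespace ScenarioProgram

variable {d n : ℕ} {Ω : Type*} [MeasurableSpace Ω]

/-- Feasible set when only the constraints of the samples with index in `A` are enforced. -/
def feasible (P : ScenarioProgram d Ω) (S : Fin n → Ω) (A : Finset (Fin n)) :
    Set (EuclideanSpace ℝ (Fin d)) :=
  {x | x ∈ P.X ∧ ∀ i ∈ A, P.g x (S i) ≤ 0}

/-- `x` is an optimal solution of: minimize `cᵀ x` over `X` subject to `g(x, S i) ≤ 0`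
for all `i ∈ A`. -/
def IsOptimal (P : ScenarioProgram d Ω) (S : Fin n → Ω) (A : Finset (Fin n))
    (x : EuclideanSpace ℝ (Fin d)) : Prop :=
  x ∈ P.feasible S A ∧ ∀ y ∈ P.feasible S A, inner ℝ P.c x ≤ inner ℝ P.c y

open scoped Classical in
/-- Support set of the program with the samples in `A`: the (indices of) samples whose removal
changes the optimal solution. -/
noncomputable def support (P : ScenarioProgram d Ω) (S : Fin n → Ω) (A : Finset (Fin n)) :
    Finset (Fin n) :=
  A.filter fun i => ∀ x y, P.IsOptimal S A x → P.IsOptimal S (A.erase i) y → x ≠ y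

/-- Samples left after `k` stages of the cascade: at each stage the program with the samples
still present is solved and its support set is discarded. -/
noncomputable def remaining (P : ScenarioProgram d Ω) (S : Fin n → Ω) : ℕ → Finset (Fin n)
  | 0 => Finset.univ
  | k + 1 => P.remaining S k \ P.support S (P.remaining S k)

/-- With probability one over `n` i.i.d. samples, the program with these samples is feasible and
has exactly one optimal solution. -/
def UniquelySolvable (P : ScenarioProgram d Ω) (ℙ : Measure Ω) (n : ℕ) : Prop :=
  ∀ᵐ S ∂(Measure.pi fun _ : Fin n => ℙ), ∃! x, P.IsOptimal S Finset.univ x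

/-- With probability one over `n` i.i.d. samples, the support set has exactly `d` elements. -/
def FullySupported (P : ScenarioProgram d Ω) (ℙ : Measure Ω) (n : ℕ) : Prop :=
  ∀ᵐ S ∂(Measure.pi fun _ : Fin n => ℙ), (P.support S Finset.univ).card = d

/-- Probability that a new sample violates the constraint at `x`. -/
noncomputable def violation (P : ScenarioProgram d Ω) (ℙ : Measure Ω)
    (x : EuclideanSpace ℝ (Fin d)) : ℝ :=
  ℙ.real {ω | 0 < P.g x ω}

end ScenarioProgram

namespace ScenarioProgram

variable {d n N : ℕ} {Ω : Type*} [MeasurableSpace Ω]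

/-! Leave-one-out argument. Draw `m + 1` samples `T`. By exchangeability, `m + 1` times the expected
violation is the expected number of `j` whose sample is violated by the solution computed from the
other samples (`lintegral_violation_eq`). Run the cascade on all of `T` for `ℓ + 1` stages. If `j`
survives, deleting it changes no discarded batch, since full support fixes the size of each batch
(`Regular.map_remaining_succAbove`), nor the final optimum, since `j` is not in the last support
set. So every violated `j` is among the `(ℓ + 1) * d = r + d` discarded ones
(`Regular.card_violating_le`). -/

lemma feasible_comp (P : ScenarioProgram d Ω) (T : Fin N → Ω) (e : Fin n ↪ Fin N)
    (A : Finset (Fin n)) : P.feasible (T ∘ e) A = P.feasible T (A.map e) := by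
  ext x
  simp [feasible]

lemma isOptimal_comp (P : ScenarioProgram d Ω) (T : Fin N → Ω) (e : Fin n ↪ Fin N)
    (A : Finset (Fin n)) (x : EuclideanSpace ℝ (Fin d)) :
    P.IsOptimal (T ∘ e) A x ↔ P.IsOptimal T (A.map e) x := by
  simp only [IsOptimal, feasible_comp]

lemma mem_support {P : ScenarioProgram d Ω} {S : Fin n → Ω} {A : Finset (Fin n)} {i : Fin n} :
    i ∈ P.support S A ↔
      i ∈ A ∧ ∀ x y, P.IsOptimal S A x → P.IsOptimal S (A.erase i) y → x ≠ y := by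
  simp [support]

lemma support_subset (P : ScenarioProgram d Ω) (S : Fin n → Ω) (A : Finset (Fin n)) :
    P.support S A ⊆ A := fun _ hi => (mem_support.1 hi).1

/-- Identifies a subprogram of `T` with a full program on fewer samples, the only kind the
hypotheses speak of. -/
lemma map_support_comp (P : ScenarioProgram d Ω) (T : Fin N → Ω) (e : Fin n ↪ Fin N)
    (A : Finset (Fin n)) : (P.support (T ∘ e) A).map e = P.support T (A.map e) := by
  ext i
  constructor
  · intro hi
    obtain ⟨a, ha, rfl⟩ := Finset.mem_map.1 hi
    rw [mem_support] at ha ⊢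
    simpa [isOptimal_comp, Finset.map_erase] using ha
  · intro hi
    obtain ⟨a, ha, rfl⟩ := Finset.mem_map.1 (P.support_subset _ _ hi)
    refine Finset.mem_map_of_mem _ ?_
    rw [mem_support] at hi ⊢
    simpa [isOptimal_comp, Finset.map_erase] using hi

lemma feasible_anti (P : ScenarioProgram d Ω) (S : Fin n → Ω) {A B : Finset (Fin n)}
    (h : A ⊆ B) : P.feasible S B ⊆ P.feasible S A :=
  fun _ hx => ⟨hx.1, fun i hi => hx.2 i (h hi)⟩

/-- Removing a sample outside the support set leaves the optimal solution unchanged. -/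
lemma IsOptimal.of_erase {P : ScenarioProgram d Ω} {S : Fin n → Ω} {B : Finset (Fin n)}
    {j : Fin n} (hjB : j ∈ B) (hj : j ∉ P.support S B)
    (hU : ∃! x, P.IsOptimal S (B.erase j) x) {x : EuclideanSpace ℝ (Fin d)}
    (hx : P.IsOptimal S (B.erase j) x) : P.IsOptimal S B x := by
  simp only [mem_support, hjB, true_and, not_forall, not_not] at hj
  obtain ⟨y, z, hy, hz, rfl⟩ := hj
  rwa [hU.unique hx hz]

/-- If deleting `i` from `B.erase j` kept the optimum `x`, then `x` would be optimal for `B` and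
also for `B.erase i`, whose feasible set lies between those of `B` and `(B.erase j).erase i`. Then
`i` would not be in the support of `B`. -/
lemma support_subset_support_erase {P : ScenarioProgram d Ω} {S : Fin n → Ω}
    {B : Finset (Fin n)} {j : Fin n} (hjB : j ∈ B) (hj : j ∉ P.support S B)
    (hU : ∃! x, P.IsOptimal S (B.erase j) x) :
    P.support S B ⊆ P.support S (B.erase j) := by
  intro i hi
  have hij : i ≠ j := fun h => hj (h ▸ hi)
  have hi' := mem_support.1 hi
  refine mem_support.2 ⟨Finset.mem_erase.2 ⟨hij, hi'.1⟩, ?_⟩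
  rintro x _ hx hy rfl
  have hxB := hx.of_erase hjB hj hU
  refine hi'.2 x x hxB ⟨P.feasible_anti S (Finset.erase_subset _ _) hxB.1, fun y hy' => ?_⟩ rfl
  refine hy.2 y (P.feasible_anti S ?_ hy')
  exact Finset.erase_subset_erase _ (Finset.erase_subset _ _)

/-- Every subprogram with at least `d` samples is uniquely solvable, and every one with more than
`d` samples is fully supported. -/
def Regular (P : ScenarioProgram d Ω) (T : Fin N → Ω) : Prop :=
  (∀ A : Finset (Fin N), d ≤ A.card → ∃! x, P.IsOptimal T A x) ∧
    ∀ A : Finset (Fin N), d < A.card → (P.support T A).card = d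

lemma remaining_anti (P : ScenarioProgram d Ω) (T : Fin N → Ω) : Antitone (P.remaining T) :=
  antitone_nat_of_succ_le fun _ => Finset.sdiff_subset

lemma Regular.card_remaining_add {P : ScenarioProgram d Ω} {T : Fin N → Ω} (hT : P.Regular T)
    {k : ℕ} (hk : k * d < N) : (P.remaining T k).card + k * d = N := by
  induction k with
  | zero => simp [remaining]
  | succ k ih =>
    rw [add_mul, one_mul] at hk ⊢
    have h := ih (by omega)
    have hs := hT.2 (P.remaining T k) (by omega)
    have hc := Finset.card_sdiff_add_card_eq_card (P.support_subset T (P.remaining T k))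
    simp only [remaining]
    omega

lemma Regular.map_remaining_succAbove {m ℓ : ℕ} {P : ScenarioProgram d Ω} {T : Fin (m + 1) → Ω}
    (hT : P.Regular T) (hm : (ℓ + 1) * d < m + 1) {j : Fin (m + 1)}
    (hj : j ∈ P.remaining T (ℓ + 1)) {k : ℕ} (hk : k ≤ ℓ) :
    (P.remaining (T ∘ j.succAboveEmb) k).map j.succAboveEmb = (P.remaining T k).erase j := by
  induction k with
  | zero =>
    ext i
    simp only [remaining, Finset.mem_map, Finset.mem_univ, true_and, Finset.mem_erase, and_true]
    exact Fin.exists_succAbove_eq_iff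
  | succ k ih =>
    have ih := ih (by omega)
    have hjk : j ∈ P.remaining T k := P.remaining_anti T (by omega) hj
    have hjs : j ∉ P.support T (P.remaining T k) := by
      have : j ∈ P.remaining T (k + 1) := P.remaining_anti T (by omega) hj
      exact (Finset.mem_sdiff.1 this).2
    have hkd : (k + 2) * d ≤ (ℓ + 1) * d := Nat.mul_le_mul_right _ (by omega)
    have h2 : (k + 2) * d = k * d + d + d := by ring
    have hcard := hT.card_remaining_add (k := k) (by omega)
    have hce := Finset.card_erase_of_mem hjk
    have hsub := support_subset_support_erase hjk hjs (hT.1 _ (by omega))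
    -- The erased set has at least `2 * d` elements, so the second case arises only for `d = 0`.
    have hle : (P.support T ((P.remaining T k).erase j)).card ≤ d := by
      rcases lt_or_ge d ((P.remaining T k).erase j).card with h | h
      · exact (hT.2 _ h).le
      · exact (Finset.card_le_card (P.support_subset _ _)).trans h
    have hs := hT.2 (P.remaining T k) (by omega)
    -- Inclusion together with equal size forces the two discarded batches to coincide.
    have heq := Finset.eq_of_subset_of_card_le hsub (by omega)
    simp only [remaining, Finset.map_sdiff, map_support_comp, ih]
    rw [← heq, Finset.erase_sdiff_comm]

/-- A sample that survives `ℓ + 1` stages of the cascade is satisfied by the solution that the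
cascade with `ℓ` stages produces from the other samples. -/
lemma Regular.nonpos_of_mem_remaining {m ℓ : ℕ} {P : ScenarioProgram d Ω} {T : Fin (m + 1) → Ω}
    (hT : P.Regular T) (hm : (ℓ + 1) * d < m + 1) {j : Fin (m + 1)}
    (hj : j ∈ P.remaining T (ℓ + 1)) {x : EuclideanSpace ℝ (Fin d)}
    (hx : P.IsOptimal (T ∘ j.succAbove) (P.remaining (T ∘ j.succAbove) ℓ) x) :
    P.g x (T j) ≤ 0 := by
  replace hx : P.IsOptimal (T ∘ j.succAboveEmb) (P.remaining (T ∘ j.succAboveEmb) ℓ) x := hx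
  have hx' := (P.isOptimal_comp T j.succAboveEmb _ x).1 hx
  rw [hT.map_remaining_succAbove hm hj le_rfl] at hx'
  have hj' := Finset.mem_sdiff.1 hj
  have h1 : (ℓ + 1) * d = ℓ * d + d := by ring
  have hcard := hT.card_remaining_add (k := ℓ) (by omega)
  have hce := Finset.card_erase_of_mem hj'.1
  exact (hx'.of_erase hj'.1 hj'.2 (hT.1 _ (by omega))).1.2 j hj'.1

open scoped Classical in
lemma Regular.card_violating_le {m ℓ : ℕ} {P : ScenarioProgram d Ω} {T : Fin (m + 1) → Ω}
    (hT : P.Regular T) (hm : (ℓ + 1) * d < m + 1)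
    {x : Fin (m + 1) → EuclideanSpace ℝ (Fin d)}
    (hx : ∀ j : Fin (m + 1),
      P.IsOptimal (T ∘ j.succAbove) (P.remaining (T ∘ j.succAbove) ℓ) (x j)) :
    (Finset.univ.filter fun j => 0 < P.g (x j) (T j)).card ≤ (ℓ + 1) * d := by
  have hsub : (Finset.univ.filter fun j => 0 < P.g (x j) (T j)) ⊆
      (P.remaining T (ℓ + 1))ᶜ := by
    intro j hj
    rw [Finset.mem_compl]
    intro h
    exact absurd (Finset.mem_filter.1 hj).2 (hT.nonpos_of_mem_remaining hm h (hx j)).not_gt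
  have hcard := hT.card_remaining_add hm
  have h := Finset.card_le_card hsub
  rw [Finset.card_compl, Fintype.card_fin] at h
  omega

/-! ### Almost sure regularity, measurability and exchangeability -/

lemma measurePreserving_comp_embedding (ℙ : Measure Ω) [IsProbabilityMeasure ℙ]
    (e : Fin n ↪ Fin N) :
    MeasurePreserving (fun T : Fin N → Ω => T ∘ e) (Measure.pi fun _ : Fin N => ℙ)
      (Measure.pi fun _ : Fin n => ℙ) := by
  refine ⟨by fun_prop, ?_⟩
  have h := ProbabilityTheory.iIndepFun_pi (μ := fun _ : Fin N => ℙ) (X := fun _ ω => ω)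
    (fun _ => measurable_id.aemeasurable)
  have h' := (ProbabilityTheory.iIndepFun_iff_map_fun_eq_pi_map
    (fun i => (measurable_pi_apply (e i)).aemeasurable)).1 (h.precomp e.injective)
  refine h'.trans ?_
  congr 1
  ext1 i
  exact (measurePreserving_eval (fun _ : Fin N => ℙ) (e i)).map_eq

/-- There are finitely many index sets `A`, and the samples indexed by each are again i.i.d. -/
lemma ae_regular (P : ScenarioProgram d Ω) (ℙ : Measure Ω) [IsProbabilityMeasure ℙ]
    (hunique : ∀ n, d ≤ n → P.UniquelySolvable ℙ n)
    (hsupp : ∀ n, d < n → P.FullySupported ℙ n) :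
    ∀ᵐ T ∂(Measure.pi fun _ : Fin N => ℙ), P.Regular T := by
  have key : ∀ A : Finset (Fin N), Finset.univ.map (A.orderEmbOfFin rfl).toEmbedding = A := by
    intro A
    simp
  refine Filter.Eventually.and (ae_all_iff.2 fun A => ?_) (ae_all_iff.2 fun A => ?_)
  · rcases le_or_gt d A.card with h | h
    · filter_upwards [(measurePreserving_comp_embedding ℙ
        (A.orderEmbOfFin rfl).toEmbedding).quasiMeasurePreserving.ae (hunique _ h)] with T hT _
      simpa only [isOptimal_comp, key] using hT
    · exact .of_forall fun T h' => absurd h' h.not_ge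
  · rcases lt_or_ge d A.card with h | h
    · filter_upwards [(measurePreserving_comp_embedding ℙ
        (A.orderEmbOfFin rfl).toEmbedding).quasiMeasurePreserving.ae (hsupp _ h)] with T hT _
      rwa [← Finset.card_map (A.orderEmbOfFin rfl).toEmbedding, map_support_comp, key] at hT
    · exact .of_forall fun T h' => absurd h' h.not_gt

/-- A finite convex function on `ℝ^d` is continuous, so `g` is a Carathéodory function. -/
lemma measurable_uncurry_g (P : ScenarioProgram d Ω) :
    Measurable fun p : EuclideanSpace ℝ (Fin d) × Ω => P.g p.1 p.2 := by
  exact measurable_uncurry_of_continuous_of_measurable (u := P.g)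
    (fun ω => continuousOn_univ.1 ((P.convex_g ω).continuousOn isOpen_univ)) P.measurable_g

lemma measurable_violation (P : ScenarioProgram d Ω) (ℙ : Measure Ω) [IsProbabilityMeasure ℙ] :
    Measurable (P.violation ℙ) :=
  (measurable_measure_prodMk_left
    (measurableSet_lt measurable_const P.measurable_uncurry_g)).ennreal_toReal

lemma violation_nonneg (P : ScenarioProgram d Ω) (ℙ : Measure Ω)
    (x : EuclideanSpace ℝ (Fin d)) : 0 ≤ P.violation ℙ x := measureReal_nonneg

lemma violation_le_one (P : ScenarioProgram d Ω) (ℙ : Measure Ω) [IsProbabilityMeasure ℙ]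
    (x : EuclideanSpace ℝ (Fin d)) : P.violation ℙ x ≤ 1 := measureReal_le_one

/-- Exchangeability: each of `m + 1` samples is equally likely to be violated by the solution
computed from the others. -/
lemma lintegral_violation_eq (P : ScenarioProgram d Ω) (ℙ : Measure Ω) [IsProbabilityMeasure ℙ]
    {m : ℕ} {x : (Fin m → Ω) → EuclideanSpace ℝ (Fin d)} (hx : Measurable x)
    (j : Fin (m + 1)) :
    ∫⁻ S, ℙ {ω | 0 < P.g (x S) ω} ∂(Measure.pi fun _ : Fin m => ℙ) =
      (Measure.pi fun _ : Fin (m + 1) => ℙ)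
        {T | 0 < P.g (x (T ∘ j.succAbove)) (T j)} := by
  have hE : MeasurableSet {p : Ω × (Fin m → Ω) | 0 < P.g (x p.2) p.1} :=
    measurableSet_lt measurable_const
      (P.measurable_uncurry_g.comp ((hx.comp measurable_snd).prodMk measurable_fst))
  have h := (measurePreserving_piFinSuccAbove (fun _ : Fin (m + 1) => ℙ) j).measure_preimage
    hE.nullMeasurableSet
  rw [Measure.prod_apply_symm hE] at h
  exact h.symm

end ScenarioProgram

open ScenarioProgram in
theorem theorem3 {d : ℕ} {Ω : Type*} [MeasurableSpace Ω] (ℙ : Measure Ω) [IsProbabilityMeasure ℙ]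
    (P : ScenarioProgram d Ω)
    (hunique : ∀ n, d ≤ n → P.UniquelySolvable ℙ n)
    (hsupp : ∀ n, d < n → P.FullySupported ℙ n)
    (m r ℓ : ℕ) (hr : r = ℓ * d)
    (xstar : (Fin m → Ω) → EuclideanSpace ℝ (Fin d))
    (hmeas : AEMeasurable xstar (Measure.pi fun _ : Fin m => ℙ))
    (hopt : ∀ᵐ S ∂(Measure.pi fun _ : Fin m => ℙ),
      P.IsOptimal S (P.remaining S ℓ) (xstar S)) :
    Integrable (fun S => P.violation ℙ (xstar S)) (Measure.pi fun _ : Fin m => ℙ) ∧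
      ∫ S, P.violation ℙ (xstar S) ∂(Measure.pi fun _ : Fin m => ℙ)
        ≤ ((r : ℝ) + d) / ((m : ℝ) + 1) := by
  have hint : Integrable (fun S => P.violation ℙ (xstar S)) (Measure.pi fun _ : Fin m => ℙ) :=
    .of_bound ((P.measurable_violation ℙ).comp_aemeasurable hmeas).aestronglyMeasurable 1
      (.of_forall fun S => by
        rw [Real.norm_of_nonneg (P.violation_nonneg ℙ _)]
        exact P.violation_le_one ℙ _)
  refine ⟨hint, ?_⟩
  rw [le_div_iff₀ (by positivity)]
  -- If `m + 1 ≤ (ℓ + 1) * d`, the claimed bound is at least 1 and there is nothing to prove.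
  rcases lt_or_ge ((ℓ + 1) * d) (m + 1) with hm | hm
  · set μ := Measure.pi fun _ : Fin m => ℙ
    set ν := Measure.pi fun _ : Fin (m + 1) => ℙ
    -- A measurable version of `xstar` makes the violation events measurable.
    set x := hmeas.mk xstar
    have hx : Measurable x := hmeas.measurable_mk
    have hoptx : ∀ᵐ S ∂μ, P.IsOptimal S (P.remaining S ℓ) (x S) := by
      filter_upwards [hopt, hmeas.ae_eq_mk] with S h1 h2
      rw [h2] at h1
      exact h1
    have hcongr : ∫ S, P.violation ℙ (xstar S) ∂μ =
        (∫⁻ S, ℙ {ω | 0 < P.g (x S) ω} ∂μ).toReal := by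
      rw [← integral_toReal]
      · refine integral_congr_ae ?_
        filter_upwards [hmeas.ae_eq_mk] with S h
        rw [h]
        rfl
      · exact ((measurable_measure_prodMk_left (measurableSet_lt measurable_const
          P.measurable_uncurry_g)).comp hx).aemeasurable
      · exact .of_forall fun S => measure_lt_top _ _
    have hopt' : ∀ᵐ T ∂ν, ∀ j : Fin (m + 1),
        P.IsOptimal (T ∘ j.succAbove) (P.remaining (T ∘ j.succAbove) ℓ)
          (x (T ∘ j.succAbove)) :=
      ae_all_iff.2 fun j =>
        (measurePreserving_comp_embedding ℙ j.succAboveEmb).quasiMeasurePreserving.ae hoptx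
    have hE : ∀ j : Fin (m + 1),
        MeasurableSet {T : Fin (m + 1) → Ω | 0 < P.g (x (T ∘ j.succAbove)) (T j)} := fun j =>
      measurableSet_lt measurable_const (P.measurable_uncurry_g.comp
        ((hx.comp (by fun_prop)).prodMk (measurable_pi_apply j)))
    have hsum : ((m + 1 : ℕ) : ENNReal) * ∫⁻ S, ℙ {ω | 0 < P.g (x S) ω} ∂μ ≤
        ((ℓ + 1) * d : ℕ) := by
      classical
      calc ((m + 1 : ℕ) : ENNReal) * ∫⁻ S, ℙ {ω | 0 < P.g (x S) ω} ∂μ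
          = ∑ j : Fin (m + 1), ν {T | 0 < P.g (x (T ∘ j.succAbove)) (T j)} := by
            simp only [ν, ← P.lintegral_violation_eq ℙ hx]
            simp [μ]
        _ = ∫⁻ T, ∑ j : Fin (m + 1),
              {T | 0 < P.g (x (T ∘ j.succAbove)) (T j)}.indicator 1 T ∂ν := by
            rw [lintegral_finsetSum _ fun j _ => measurable_one.indicator (hE j)]
            exact Finset.sum_congr rfl fun j _ => (lintegral_indicator_one (hE j)).symm
        _ ≤ ∫⁻ _, (((ℓ + 1) * d : ℕ) : ENNReal) ∂ν := by
            refine lintegral_mono_ae ?_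
            filter_upwards [P.ae_regular ℙ hunique hsupp, hopt'] with T hT h
            have := hT.card_violating_le hm h
            simp only [Set.indicator_apply, Set.mem_ofPred_eq, Pi.one_apply, Finset.sum_boole]
            exact_mod_cast this
        _ = ((ℓ + 1) * d : ℕ) := by simp [ν]
    have := ENNReal.toReal_mono (ENNReal.natCast_ne_top _) hsum
    rw [ENNReal.toReal_mul, ENNReal.toReal_natCast, ENNReal.toReal_natCast, ← hcongr] at this
    push_cast at this
    rw [hr]
    push_cast
    linarith
  · have h1 : ∫ S, P.violation ℙ (xstar S) ∂(Measure.pi fun _ : Fin m => ℙ) ≤ 1 := by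
      simpa using integral_mono hint (integrable_const 1) fun S => P.violation_le_one ℙ (xstar S)
    have h2 : ((m : ℝ) + 1) ≤ (ℓ + 1) * d := by exact_mod_cast hm
    rw [hr]
    push_cast
    nlinarith
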